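/- **Theorem 1.2.** Let $(M,g)$ be a smooth Riemannian manifold (without boundary, second countable), with Riemannian volume measure $\mu$, and let $1<p<\infty$, $\frac1p+\frac1q=1$. A *weak divergence* of a measurable vector field $X$ on $M$ with $\|X\|\in L^1_{loc}(M)$ is a function $h\in L^1_{loc}(M)$ such that $$\int_M \varphi\,h\,d\mu=-\int_M g(\nabla\varphi,X)\,d\mu\qquad\text{for all }\varphi\in C_0^\infty(M);$$ it is unique up to null sets and is denoted by $\mathrm{Div}\,X$. Let $\mathcal W^{1,1}(M)$ be the space of all such $X$ that possess a weak divergence, and put $$S=\sup_{X\in\mathcal W^{1,1}(M)}\ \inf_M\big((1-p)\|X\|^q+\mathrm{Div}\,X\big)\in[-\infty,\infty],$$ where $\inf_M$ denotes the essential infimum. For an open set $\Omega\subseteq M$ let $W^{1,p}_0(\Omega)$ be the closure of $C_0^\infty(\Omega)$ (smooth functions with compact support in $\Omega$) in the norm $\|u\|_{1,p}^p=\int_\Omega|u|^p\,d\mu+\int_\Omega\|\nabla u\|^p\,d\mu$, and let $$\mu_p^*(\Omega)=\inf\left\{\frac{\int_\Omega\|\nabla u\|^p\,d\mu}{\int_\Omega|u|^p\,d\mu}\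 :\ u\in W_0^{1,p}(\Omega),\ u\ne0\right\}\in[0,\infty].$$ Then $\mu_p^*(M)\ge S$, for each of the usual meanings of the $p$-fundamental tone $\mu_p^*(M)$ of $M$: 1. $\mu_p^*(M)\ge S$, where $\mu_p^*(M)$ is the infimum above with $\Omega=M$. 2. For every $o\in M$ the limit $\lim_{r\to\infty}\mu_p^*(B_r(o))$ over the geodesic balls with centre $o$ exists in $[0,\infty]$ and is $\ge S$. (This limit is the definition of $\mu_p^*(M)$ when $M$ is complete and noncompact.) 3. If $M$ is closed (compact), then $$\mu_{1,p}(M)=\inf\left\{\frac{\int_M\|\nabla u\|^p\,d\mu}{\int_M|u|^p\,d\mu}\ :\ u\in W^{1,p}(M),\ u\neq0,\ \int_M|u|^{p-2}u\,d\mu=0\right\}\ \ge\ S.$$ -/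

import Mathlib

open Set Filter Topology MeasureTheory Manifold
open scoped ENNReal ContDiff Bundle

noncomputable section

namespace PTone

section Metric

/-! ### Gradient, volume, smooth test functions -/

instance tangentFiniteDimensional {n : ℕ} {M : Type*} [TopologicalSpace M]
    [ChartedSpace (EuclideanSpace ℝ (Fin n)) M] (x : M) :
    FiniteDimensional ℝ (TangentSpace (𝓡 n) x) :=
  inferInstanceAs (FiniteDimensional ℝ (EuclideanSpace ℝ (Fin n)))

variable {n : ℕ} {M : Type*} [TopologicalSpace M] [ChartedSpace (EuclideanSpace ℝ (Fin n)) M]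
  [Bundle.RiemannianBundle (fun x : M => TangentSpace (𝓡 n) x)]

instance tangentComplete (x : M) : CompleteSpace (TangentSpace (𝓡 n) x) :=
  FiniteDimensional.complete ℝ _

/-- The Riemannian gradient `∇f`: the vector field with `g(∇f, v) = df(v)`. -/
def grad (f : M → ℝ) (x : M) : TangentSpace (𝓡 n) x :=
  (InnerProductSpace.toDual ℝ (TangentSpace (𝓡 n) x)).symm (mfderiv (𝓡 n) 𝓘(ℝ, ℝ) f x)

theorem inner_grad (f : M → ℝ) (x : M) (v : TangentSpace (𝓡 n) x) :
    inner ℝ (grad f x) v = mfderiv (𝓡 n) 𝓘(ℝ, ℝ) f x v :=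
  InnerProductSpace.toDual_symm_apply

variable (n) in
/-- The coordinate vector field `∂ᵢ` of the preferred chart at `x₀`, at the point with
coordinates `y`. -/
def coordVec (x₀ : M) (y : EuclideanSpace ℝ (Fin n)) (i : Fin n) :
    TangentSpace (𝓡 n) ((chartAt (EuclideanSpace ℝ (Fin n)) x₀).symm y) :=
  mfderiv (𝓡 n) (𝓡 n) (chartAt (EuclideanSpace ℝ (Fin n)) x₀).symm y
    (EuclideanSpace.single i (1 : ℝ))

variable (n) in
/-- The volume density `√(det (g_ij))` in the preferred chart at `x₀`, where
`g_ij = g(∂ᵢ, ∂ⱼ)`. -/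
def volumeDensity (x₀ : M) (y : EuclideanSpace ℝ (Fin n)) : ℝ :=
  Real.sqrt (Matrix.gram ℝ (coordVec n x₀ y)).det

variable [MeasurableSpace M]

variable (n) in
/-- The Riemannian volume of the domain of the preferred chart at `x₀` (extended by zero to `M`):
the measure `√(det (g_ij)) dy¹ ⋯ dyⁿ` on the target of the chart, carried to `M`. -/
def chartVolume (x₀ : M) : Measure M :=
  ((volume.restrict (chartAt (EuclideanSpace ℝ (Fin n)) x₀).target).withDensity
    (fun y => ENNReal.ofReal (volumeDensity n x₀ y))).map
      (chartAt (EuclideanSpace ℝ (Fin n)) x₀).symm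

variable (n) in
/-- The volume of a set that lies in the domain of a chart, `⊤` for all other sets. -/
def smallVolume (s : Set M) : ℝ≥0∞ :=
  ⨅ (x₀ : M) (_ : s ⊆ (chartAt (EuclideanSpace ℝ (Fin n)) x₀).source), chartVolume n x₀ s

theorem smallVolume_caratheodory {s : Set M} (hs : MeasurableSet s) (t : Set M) :
    smallVolume n (t ∩ s) + smallVolume n (t \ s) ≤ smallVolume n t := by
  refine le_iInf₂ fun x₀ h => ?_
  calc smallVolume n (t ∩ s) + smallVolume n (t \ s)
      ≤ chartVolume n x₀ (t ∩ s) + chartVolume n x₀ (t \ s) :=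
        add_le_add (iInf₂_le x₀ (inter_subset_left.trans h)) (iInf₂_le x₀ (sdiff_subset.trans h))
    _ = chartVolume n x₀ t := measure_inter_add_sdiff t hs

variable (n M) in
/-- The Riemannian volume measure of `M`: the volume of a set is the infimum of
`∑ vol(sₖ)` over its countable covers by sets `sₖ` each of which lies in the domain of a chart and
is measured there by `√(det (g_ij)) dy`. -/
def riemannianVolume : Measure M :=
  (OuterMeasure.boundedBy (smallVolume n (M := M))).toMeasure
    (fun _ hs => OuterMeasure.boundedBy_caratheodory (smallVolume_caratheodory hs))

variable (n) in
/-- `φ ∈ C₀^∞(Ω)`: smooth, with compact support contained in `Ω`. -/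
structure IsTestFunction (Ω : Set M) (φ : M → ℝ) : Prop where
  smooth : ContMDiff (𝓡 n) 𝓘(ℝ, ℝ) ∞ φ
  compact : HasCompactSupport φ
  subset : tsupport φ ⊆ Ω

end Metric

section Sobolev

variable {n : ℕ} {M : Type*} [TopologicalSpace M] [ChartedSpace (EuclideanSpace ℝ (Fin n)) M]
  [IsManifold (𝓡 n) ∞ M] [Bundle.RiemannianBundle (fun x : M => TangentSpace (𝓡 n) x)]
  [MeasurableSpace M]

/-- A vector field that is measurable on `Ω`, up to a null set. -/
def MeasurableField (Ω : Set M) (X : (x : M) → TangentSpace (𝓡 n) x) : Prop :=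
  AEStronglyMeasurable (fun x => (⟨x, X x⟩ : TangentBundle (𝓡 n) M))
    ((riemannianVolume n M).restrict Ω)

/-- `h` is a weak divergence of `X` on `M`. -/
structure IsWeakDivergence (X : (x : M) → TangentSpace (𝓡 n) x) (h : M → ℝ) : Prop where
  measurable : MeasurableField univ X
  locallyIntegrable_norm : LocallyIntegrable (fun x => ‖X x‖) (riemannianVolume n M)
  locallyIntegrable : LocallyIntegrable h (riemannianVolume n M)
  integral_eq : ∀ φ : M → ℝ, IsTestFunction n univ φ →
    ∫ x, φ x * h x ∂(riemannianVolume n M) =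
      - ∫ x, inner ℝ (grad φ x) (X x) ∂(riemannianVolume n M)

variable (n M) in
/-- `sup { inf_M ((1 - p) ‖X‖^q + Div X) : X ∈ 𝒲^{1,1}(M) }`, an extended real number. Here
`𝒲^{1,1}(M)` is the space of the locally integrable vector fields `X` that possess a weak
divergence `h = Div X` (which is unique up to null sets), and the infimum of a function that is
defined up to null sets is its essential infimum. -/
def divergenceSup (p q : ℝ) : EReal :=
  ⨆ (X : (x : M) → TangentSpace (𝓡 n) x) (h : M → ℝ) (_ : IsWeakDivergence X h),
    essInf (fun x => (((1 - p) * ‖X x‖ ^ q + h x : ℝ) : EReal)) (riemannianVolume n M)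

/-- `u ∈ W₀^{1,p}(Ω)` with gradient `∇u = G`: there are `φₖ ∈ C₀^∞(Ω)` such that `φₖ → u` and
`∇φₖ → G` in `L^p(Ω)`. This describes the closure of `C₀^∞(Ω)` in the Sobolev norm. -/
structure IsSobolevZero (p : ℝ) (Ω : Set M) (u : M → ℝ) (G : (x : M) → TangentSpace (𝓡 n) x) :
    Prop where
  memLp : MemLp u (ENNReal.ofReal p) ((riemannianVolume n M).restrict Ω)
  measurable : MeasurableField Ω G
  approx : ∃ φ : ℕ → M → ℝ, (∀ k, IsTestFunction n Ω (φ k)) ∧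
    Tendsto (fun k => ∫⁻ x in Ω, ‖φ k x - u x‖ₑ ^ p ∂(riemannianVolume n M)) atTop (𝓝 0) ∧
    Tendsto (fun k => ∫⁻ x in Ω, ‖grad (φ k) x - G x‖ₑ ^ p ∂(riemannianVolume n M)) atTop (𝓝 0)

/-- The Rayleigh quotient `∫_Ω ‖∇u‖^p / ∫_Ω |u|^p`, with `∇u = G`. -/
def rayleigh (p : ℝ) (Ω : Set M) (u : M → ℝ) (G : (x : M) → TangentSpace (𝓡 n) x) : ℝ≥0∞ :=
  (∫⁻ x in Ω, ‖G x‖ₑ ^ p ∂(riemannianVolume n M)) /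
    (∫⁻ x in Ω, ‖u x‖ₑ ^ p ∂(riemannianVolume n M))

variable (n) in
/-- The `p`-fundamental tone `μ_p^*(Ω)`: the infimum of the Rayleigh quotients of the nonzero
`u ∈ W₀^{1,p}(Ω)`. -/
def fundamentalTone (p : ℝ) (Ω : Set M) : ℝ≥0∞ :=
  ⨅ (u : M → ℝ) (G : (x : M) → TangentSpace (𝓡 n) x) (_ : IsSobolevZero p Ω u G)
    (_ : ¬ u =ᵐ[(riemannianVolume n M).restrict Ω] 0), rayleigh p Ω u G

variable (n M) in
/-- For a closed manifold `M`, the first nonzero eigenvalue `μ_{1,p}(M)`: the infimum of the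
Rayleigh quotients of the nonzero `u ∈ W^{1,p}(M)` with `∫_M |u|^{p-2} u = 0`. As `M` is compact,
all smooth functions have compact support, and `W^{1,p}(M) = W₀^{1,p}(M)`. -/
def closedTone (p : ℝ) : ℝ≥0∞ :=
  ⨅ (u : M → ℝ) (G : (x : M) → TangentSpace (𝓡 n) x) (_ : IsSobolevZero p univ u G)
    (_ : ¬ u =ᵐ[riemannianVolume n M] 0)
    (_ : ∫ x, |u x| ^ (p - 2) * u x ∂(riemannianVolume n M) = 0), rayleigh p univ u G

end Sobolev

end PTone

end

/-! This is a weak Barta argument. Fix `X` with divergence `h` and a real `c > 0` below the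
essential infimum of `(1 - p) ‖X‖^q + h`. Formally, test the divergence identity with `|φ|^p`:
Young's inequality bounds `-p |φ|^(p-1) g(∇|φ|, X)` by `‖∇φ‖^p + (p - 1) |φ|^p ‖X‖^q`, so `c ∫ |φ|^p
≤ ∫ ‖∇φ‖^p`. Since `|φ|^p` need not be smooth, `smoothAbsPow p ε ∘ φ` replaces it, with an error of
order `ε ^ p`; this is `mul_lintegral_le_lintegral_grad`.

Minkowski's inequality carries the bound over to the Sobolev closure
(`IsSobolevZero.mul_lintegral_le`). The tone of balls decreases in the radius, so its limit exists
and inherits the bound; the closed eigenvalue is an infimum over fewer functions. -/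

noncomputable section

namespace PTone

/-! ### Real-variable inequalities: Minkowski, the regularized power, Young. -/

section Analysis

/-- Minkowski's inequality for a majorant `g + d` of which only `g` need be measurable. -/
theorem lintegral_Lp_le_of_le_add {α : Type*} [MeasurableSpace α] {μ : Measure α}
    {f g d : α → ℝ≥0∞} {p : ℝ} (hp : 1 ≤ p) (hg : AEMeasurable g μ) (h : ∀ x, f x ≤ g x + d x) :
    (∫⁻ x, f x ^ p ∂μ) ^ (1 / p) ≤
      (∫⁻ x, g x ^ p ∂μ) ^ (1 / p) + (∫⁻ x, d x ^ p ∂μ) ^ (1 / p) := by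
  have hp0 : 0 < p := by linarith
  -- The lower integral of `f ^ p` is attained by a measurable minorant `F`; then `F ^ (1 / p) - g`
  -- is a measurable substitute for `d`.
  obtain ⟨F, hF, hFle, hFeq⟩ := exists_measurable_le_lintegral_eq μ (fun x => f x ^ p)
  have hroot : ∀ x, F x ^ (1 / p) ≤ f x := fun x =>
    (ENNReal.rpow_le_rpow (hFle x) (by positivity)).trans_eq
      (by rw [← ENNReal.rpow_mul, mul_one_div_cancel hp0.ne', ENNReal.rpow_one])
  have hFm : AEMeasurable (fun x => F x ^ (1 / p)) μ := (hF.pow_const _).aemeasurable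
  calc (∫⁻ x, f x ^ p ∂μ) ^ (1 / p)
      ≤ (∫⁻ x, (g + fun x => F x ^ (1 / p) - g x) x ^ p ∂μ) ^ (1 / p) := by
        rw [hFeq]
        gcongr with x
        calc F x = (F x ^ (1 / p)) ^ p := by
              rw [← ENNReal.rpow_mul, one_div_mul_cancel hp0.ne', ENNReal.rpow_one]
          _ ≤ _ := by
              gcongr
              exact le_add_tsub
    _ ≤ (∫⁻ x, g x ^ p ∂μ) ^ (1 / p) + (∫⁻ x, (F x ^ (1 / p) - g x) ^ p ∂μ) ^ (1 / p) :=
        ENNReal.lintegral_Lp_add_le hg (hFm.sub hg) hp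
    _ ≤ _ := by
        gcongr with x
        exact tsub_le_iff_left.2 ((hroot x).trans (h x))

/-- A smooth approximation of `|t| ^ p` that vanishes at `0`. -/
def smoothAbsPow (p ε t : ℝ) : ℝ := √(t ^ 2 + ε ^ 2) ^ p - ε ^ p

theorem smoothAbsPow_zero {p ε : ℝ} (hε : 0 < ε) : smoothAbsPow p ε 0 = 0 := by
  simp [smoothAbsPow, Real.sqrt_sq hε.le]

theorem smoothAbsPow_nonneg {p ε : ℝ} (hp : 0 ≤ p) (hε : 0 < ε) (t : ℝ) :
    0 ≤ smoothAbsPow p ε t :=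
  sub_nonneg.2 (Real.rpow_le_rpow hε.le (Real.le_sqrt_of_sq_le (by nlinarith [sq_nonneg t])) hp)

theorem abs_rpow_le_smoothAbsPow_add {p : ℝ} (hp : 0 ≤ p) (ε t : ℝ) :
    |t| ^ p ≤ smoothAbsPow p ε t + ε ^ p := by
  rw [smoothAbsPow, sub_add_cancel]
  exact Real.rpow_le_rpow (abs_nonneg t) (Real.abs_le_sqrt (by nlinarith [sq_nonneg ε])) hp

theorem contDiff_smoothAbsPow {p ε : ℝ} (hε : 0 < ε) : ContDiff ℝ ∞ (smoothAbsPow p ε) := by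
  have hpos : ∀ t : ℝ, t ^ 2 + ε ^ 2 ≠ 0 := fun t => by positivity
  refine ContDiff.sub ?_ contDiff_const
  refine ContDiff.rpow_const_of_ne (ContDiff.sqrt (by fun_prop) hpos) fun t => ?_
  exact (Real.sqrt_pos.2 (by positivity)).ne'

/-- With `s = √(t² + ε²)` the derivative is `p s^(p-1) · t/s`, and `|t| ≤ s`. -/
theorem abs_deriv_smoothAbsPow_le {p ε : ℝ} (hp : 0 ≤ p) (hε : 0 < ε) (t : ℝ) :
    |deriv (smoothAbsPow p ε) t| ≤ p * √(t ^ 2 + ε ^ 2) ^ (p - 1) := by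
  have hpos : 0 < t ^ 2 + ε ^ 2 := by positivity
  set s := √(t ^ 2 + ε ^ 2) with hs
  have hs0 : 0 < s := Real.sqrt_pos.2 hpos
  have h1 : HasDerivAt (fun t : ℝ => √(t ^ 2 + ε ^ 2)) (2 * t / (2 * s)) t := by
    have : HasDerivAt (fun t : ℝ => t ^ 2 + ε ^ 2) (2 * t) t := by
      simpa using (hasDerivAt_pow 2 t).add_const (ε ^ 2)
    exact this.sqrt hpos.ne'
  have h2 : HasDerivAt (smoothAbsPow p ε) (2 * t / (2 * s) * p * s ^ (p - 1)) t :=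
    (h1.rpow_const (Or.inl hs0.ne')).sub_const _
  have h3 : |2 * t / (2 * s)| ≤ 1 := by
    rw [mul_div_mul_left _ _ two_ne_zero, abs_div, abs_of_pos hs0, div_le_one hs0]
    exact Real.abs_le_sqrt (by nlinarith [sq_nonneg ε])
  rw [h2.deriv, abs_mul, abs_mul, abs_of_nonneg hp, abs_of_nonneg (Real.rpow_nonneg hs0.le _),
    mul_assoc]
  exact mul_le_of_le_one_left (by positivity) h3

/-- Young's inequality for `b` and `a^(p-1) y`, multiplied by `p`; here `(p - 1) q = p` and `p / q =
p - 1`. -/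
theorem young_weighted {p q : ℝ} (hpq : p.HolderConjugate q) {a b y : ℝ} (ha : 0 ≤ a)
    (hb : 0 ≤ b) (hy : 0 ≤ y) :
    p * a ^ (p - 1) * b * y ≤ b ^ p + (p - 1) * a ^ p * y ^ q := by
  have h := Real.young_inequality_of_nonneg hb (mul_nonneg (Real.rpow_nonneg ha (p - 1)) hy) hpq
  have h1 : (a ^ (p - 1) * y) ^ q = a ^ p * y ^ q := by
    rw [Real.mul_rpow (Real.rpow_nonneg ha _) hy, ← Real.rpow_mul ha, hpq.sub_one_mul_conj]
  have h2 : p / q = p - 1 := hpq.div_conj_eq_sub_one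
  rw [h1] at h
  calc p * a ^ (p - 1) * b * y = p * (b * (a ^ (p - 1) * y)) := by ring
    _ ≤ p * (b ^ p / p + a ^ p * y ^ q / q) := mul_le_mul_of_nonneg_left h hpq.nonneg
    _ = b ^ p + p / q * (a ^ p * y ^ q) := by
        have := hpq.ne_zero
        field_simp
    _ = _ := by rw [h2]; ring

end Analysis

/-! ### Gradients and compositions of test functions. -/

section Gradient

variable {n : ℕ} {M : Type*} [TopologicalSpace M] [ChartedSpace (EuclideanSpace ℝ (Fin n)) M]

theorem IsTestFunction.mono {Ω Ω' : Set M} {φ : M → ℝ} (h : IsTestFunction n Ω φ)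
    (hΩ : Ω ⊆ Ω') : IsTestFunction n Ω' φ :=
  ⟨h.smooth, h.compact, h.subset.trans hΩ⟩

theorem IsTestFunction.comp {Ω : Set M} {φ : M → ℝ} (h : IsTestFunction n Ω φ) {F : ℝ → ℝ}
    (hF : ContDiff ℝ ∞ F) (h0 : F 0 = 0) : IsTestFunction n Ω (F ∘ φ) where
  smooth := hF.contMDiff.comp h.smooth
  compact := h.compact.comp_left h0
  subset := (closure_mono (Function.support_comp_subset h0 φ)).trans h.subset

variable [Bundle.RiemannianBundle (fun x : M => TangentSpace (𝓡 n) x)]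

theorem grad_eq_zero_of_notMem_tsupport {φ : M → ℝ} {x : M} (hx : x ∉ tsupport φ) :
    grad φ x = (0 : TangentSpace (𝓡 n) x) := by
  have h : φ =ᶠ[𝓝 x] fun _ => (0 : ℝ) := notMem_tsupport_iff_eventuallyEq.1 hx
  rw [grad, h.mfderiv_eq, mfderiv_const]
  exact map_zero (InnerProductSpace.toDual ℝ (TangentSpace (𝓡 n) x)).symm

theorem grad_comp {φ : M → ℝ} {x : M} (hφ : MDifferentiableAt (𝓡 n) 𝓘(ℝ, ℝ) φ x) {F : ℝ → ℝ}
    (hF : DifferentiableAt ℝ F (φ x)) :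
    grad (F ∘ φ) x = deriv F (φ x) • (grad φ x : TangentSpace (𝓡 n) x) := by
  refine ext_inner_right ℝ fun v => ?_
  rw [inner_grad, real_inner_smul_left, inner_grad,
    mfderiv_comp x hF.mdifferentiableAt hφ, mfderiv_eq_fderiv]
  change fderiv ℝ F (φ x) (mfderiv (𝓡 n) 𝓘(ℝ, ℝ) φ x v) = _
  exact (fderiv_eq_smul_deriv _).trans (mul_comm _ _)

end Gradient
section Support

variable {n : ℕ} {M : Type*} [TopologicalSpace M] [ChartedSpace (EuclideanSpace ℝ (Fin n)) M]
  [Bundle.RiemannianBundle (fun x : M => TangentSpace (𝓡 n) x)] [MeasurableSpace M]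

/-- The gradient vanishes off `Ω`. Only the inequality is claimed, as it holds for arbitrary `Ω`,
measurable or not. -/
theorem lintegral_grad_le_of_tsupport_subset {p : ℝ} (hp : 0 < p) {Ω : Set M} {φ : M → ℝ}
    (hφ : tsupport φ ⊆ Ω) :
    ∫⁻ x, ‖(grad φ x : TangentSpace (𝓡 n) x)‖ₑ ^ p ∂riemannianVolume n M ≤
      ∫⁻ x in Ω, ‖(grad φ x : TangentSpace (𝓡 n) x)‖ₑ ^ p ∂riemannianVolume n M := by
  have h : (fun x => ‖(grad φ x : TangentSpace (𝓡 n) x)‖ₑ ^ p) =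
      Ω.indicator fun x => ‖(grad φ x : TangentSpace (𝓡 n) x)‖ₑ ^ p := by
    refine (indicator_eq_self.2 fun x hx => ?_).symm
    by_contra hΩ
    refine hx ?_
    simp only [grad_eq_zero_of_notMem_tsupport (n := n) fun h => hΩ (hφ h)]
    simp [hp]
  calc _ = ∫⁻ x, Ω.indicator (fun x => ‖(grad φ x : TangentSpace (𝓡 n) x)‖ₑ ^ p) x
        ∂riemannianVolume n M := by
        rw [← h]
    _ ≤ _ := lintegral_indicator_le _ _

end Support

/-! ### The Barta inequality for test functions. -/

section Tone

variable {n : ℕ} {M : Type*} [EMetricSpace M] [ChartedSpace (EuclideanSpace ℝ (Fin n)) M]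
  [IsManifold (𝓡 n) ∞ M] [Bundle.RiemannianBundle (fun x : M => TangentSpace (𝓡 n) x)]
  [SecondCountableTopology M] [MeasurableSpace M] [BorelSpace M]

local notation "μM" => riemannianVolume n M

/-- The weak form of Barta's inequality, for a test function. -/
theorem mul_lintegral_le_lintegral_grad {p q : ℝ} (hpq : p.HolderConjugate q)
    {X : (x : M) → TangentSpace (𝓡 n) x} {h : M → ℝ} (hX : IsWeakDivergence X h) {c : ℝ}
    (hc : 0 < c) (hXc : ∀ᵐ x ∂μM, c ≤ (1 - p) * ‖X x‖ ^ q + h x) {φ : M → ℝ}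
    (hφ : IsTestFunction n univ φ) :
    ENNReal.ofReal c * ∫⁻ x, ‖φ x‖ₑ ^ p ∂μM ≤
      ∫⁻ x, ‖(grad φ x : TangentSpace (𝓡 n) x)‖ₑ ^ p ∂μM := by
  have hp0 : 0 < p := hpq.pos
  have hp1 : 0 < p - 1 := hpq.sub_one_pos
  set A := ∫⁻ x, ‖(grad φ x : TangentSpace (𝓡 n) x)‖ₑ ^ p ∂μM with hA
  rcases eq_or_ne A ⊤ with hAt | hAt
  · rw [hAt]; exact le_top
  set K := tsupport φ with hK
  have hKc : IsCompact K := hφ.compact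
  have hKm : MeasurableSet K := (isClosed_tsupport φ).measurableSet
  set Y : M → ℝ := fun x => ‖X x‖ ^ q with hY
  have hY0 : ∀ x, 0 ≤ Y x := fun x => Real.rpow_nonneg (norm_nonneg _) _
  have hhK : IntegrableOn h K μM := hX.locallyIntegrable.integrableOn_isCompact hKc
  have hYm : AEStronglyMeasurable Y μM :=
    (hX.locallyIntegrable_norm.aestronglyMeasurable.aemeasurable.pow_const q).aestronglyMeasurable
  -- The lower bound on `(1 - p) Y + h` gives both `(p - 1) Y ≤ h` and `c ≤ h`, so integrability of
  -- `Y` on `K` and finiteness of `μM K` both follow from that of `h`.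
  have hYK : IntegrableOn Y K μM := by
    refine (hhK.const_mul (p - 1)⁻¹).mono' hYm.restrict (ae_restrict_of_ae ?_)
    filter_upwards [hXc] with x hx
    rw [Real.norm_of_nonneg (hY0 x), le_inv_mul_iff₀ hp1]
    change (p - 1) * ‖X x‖ ^ q ≤ h x
    linarith
  have hμK : μM K < ⊤ := by
    have h1 : IntegrableOn (fun _ => c) K μM := by
      refine hhK.mono' aestronglyMeasurable_const (ae_restrict_of_ae ?_)
      filter_upwards [hXc] with x hx
      rw [Real.norm_of_nonneg hc.le]
      have := mul_nonneg hp1.le (hY0 x)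
      change 0 ≤ (p - 1) * ‖X x‖ ^ q at this
      linarith
    simpa [integrableOn_const_iff, hc.ne'] using h1
  have hφc : Continuous φ := hφ.smooth.continuous
  have hφ0 : ∀ x, x ∉ K → φ x = 0 := fun x hx => image_eq_zero_of_notMem_tsupport hx
  have hbdd : ∀ {f w : M → ℝ}, Continuous f → (∀ x, x ∉ K → f x = 0) → IntegrableOn w K μM →
      Integrable (fun x => f x * w x) μM := by
    intro f w hf hf0 hw
    refine (integrableOn_iff_integrable_of_support_subset (s := K) fun x hx => ?_).1
      (hw.continuousOn_mul hf.continuousOn hKc)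
    by_contra hxK
    exact hx (by simp [hf0 x hxK])
  have hint1 : IntegrableOn (fun _ => (1 : ℝ)) K μM := by
    simp [integrableOn_const_iff, hμK]
  have habs_cont : Continuous fun x => |φ x| ^ p := by
    exact (continuous_abs.comp hφc).rpow_const fun x => Or.inr hp0.le
  have habs_int : Integrable (fun x => |φ x| ^ p) μM := by
    simpa using hbdd habs_cont (fun x hx => by simp [hφ0 x hx, hp0.ne']) hint1
  set J := ∫ x, |φ x| ^ p ∂μM with hJ
  -- Coefficient of `ε ^ p`: the first term comes from replacing `|φ|^p` by its regularization, the
  -- second from Young's inequality.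
  set R := c * (μM).real K + (p - 1) * ∫ x in K, Y x ∂μM with hR
  have key : ∀ ε : ℝ, 0 < ε → c * J ≤ A.toReal + ε ^ p * R := by
    intro ε hε
    set F := smoothAbsPow p ε with hF
    have hFs : ContDiff ℝ ∞ F := contDiff_smoothAbsPow hε
    have hF0 : F 0 = 0 := smoothAbsPow_zero hε
    have hψ : IsTestFunction n univ (F ∘ φ) := hφ.comp hFs hF0
    have hψc : Continuous (F ∘ φ) := hψ.smooth.continuous
    have hψ0 : ∀ x, x ∉ K → (F ∘ φ) x = 0 := fun x hx => by simp [hφ0 x hx, hF0]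
    have hψnn : ∀ x, 0 ≤ (F ∘ φ) x := fun x => smoothAbsPow_nonneg hp0.le hε _
    have hψh := hbdd hψc hψ0 hhK
    have hψY := hbdd hψc hψ0 hYK
    have hψ1 : Integrable (F ∘ φ) μM := by
      simpa only [mul_one] using hbdd hψc hψ0 hint1
    have hYind : Integrable (K.indicator Y) μM := hYK.integrable_indicator hKm
    -- On `K` this is the Young term `(p - 1) s^p Y`, because `s^p = F (φ x) + ε^p` for `s = √(φ x ^
    -- 2 + ε ^ 2)`.
    set W : M → ℝ := fun x => (p - 1) * ((F ∘ φ) x * Y x + ε ^ p * K.indicator Y x) with hW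
    have hWint : Integrable W μM := (hψY.add (hYind.const_mul _)).const_mul _
    have hW0 : ∀ x, 0 ≤ W x := fun x => mul_nonneg hp1.le (add_nonneg
      (mul_nonneg (hψnn x) (hY0 x)) (mul_nonneg (Real.rpow_nonneg hε.le _)
        (indicator_nonneg (fun x _ => hY0 x) x)))
    have hpt : ∀ x, ‖(inner ℝ (grad (F ∘ φ) x) (X x) : ℝ)‖ₑ ≤
        ‖(grad φ x : TangentSpace (𝓡 n) x)‖ₑ ^ p + ENNReal.ofReal (W x) := by
      intro x
      by_cases hx : x ∈ K
      · have hy : ‖(inner ℝ (grad (F ∘ φ) x) (X x) : ℝ)‖ ≤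
            ‖(grad φ x : TangentSpace (𝓡 n) x)‖ ^ p + W x := by
          calc ‖(inner ℝ (grad (F ∘ φ) x) (X x) : ℝ)‖
              ≤ ‖(grad (F ∘ φ) x : TangentSpace (𝓡 n) x)‖ * ‖X x‖ := norm_inner_le_norm _ _
            _ = |deriv F (φ x)| * ‖(grad φ x : TangentSpace (𝓡 n) x)‖ * ‖X x‖ := by
                rw [grad_comp (hφ.smooth.mdifferentiableAt (by simp))
                  (hFs.differentiable (by simp) _), norm_smul, Real.norm_eq_abs]
            _ ≤ p * √(φ x ^ 2 + ε ^ 2) ^ (p - 1) * ‖(grad φ x : TangentSpace (𝓡 n) x)‖ *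
                  ‖X x‖ := by
                gcongr
                exact abs_deriv_smoothAbsPow_le hp0.le hε _
            _ ≤ _ := young_weighted hpq (Real.sqrt_nonneg _) (norm_nonneg _) (norm_nonneg _)
            _ = _ := by
                simp only [hW, hF, hY, smoothAbsPow, Function.comp_apply, indicator_of_mem hx]
                ring
        rw [Real.enorm_eq_ofReal_abs, ← Real.norm_eq_abs, ← ofReal_norm,
          ENNReal.ofReal_rpow_of_nonneg (norm_nonneg _) hp0.le,
          ← ENNReal.ofReal_add (Real.rpow_nonneg (norm_nonneg _) _) (hW0 x)]
        exact ENNReal.ofReal_le_ofReal hy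
      · have hx' : x ∉ tsupport (F ∘ φ) := fun h' =>
          hx (closure_mono (Function.support_comp_subset hF0 φ) h')
        rw [grad_eq_zero_of_notMem_tsupport hx', inner_zero_left, enorm_zero]
        exact zero_le
    have hdiv : ∫ x, (F ∘ φ) x * h x ∂μM ≤ A.toReal + ∫ x, W x ∂μM := by
      rw [hX.integral_eq _ hψ]
      refine (neg_le_abs _).trans ?_
      rw [← Real.norm_eq_abs]
      -- Passing to `∫⁻` avoids any measurability of `∇φ`; splitting the sum below needs only that
      -- of `W`.
      refine (norm_integral_le_lintegral_norm _).trans ?_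
      have hWtop : ENNReal.ofReal (∫ x, W x ∂μM) ≠ ⊤ := ENNReal.ofReal_ne_top
      rw [← ENNReal.toReal_ofReal (integral_nonneg hW0), ← ENNReal.toReal_add hAt hWtop]
      refine ENNReal.toReal_mono (ENNReal.add_ne_top.2 ⟨hAt, hWtop⟩) ?_
      rw [ofReal_integral_eq_lintegral_ofReal hWint (ae_of_all _ hW0), hA,
        ← lintegral_add_right' _ hWint.aemeasurable.ennreal_ofReal]
      refine lintegral_mono fun x => ?_
      rw [ofReal_norm]
      exact hpt x
    have hWval : ∫ x, W x ∂μM =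
        (p - 1) * (∫ x, (F ∘ φ) x * Y x ∂μM + ε ^ p * ∫ x in K, Y x ∂μM) := by
      simp only [hW]
      rw [integral_const_mul, integral_add hψY (hYind.const_mul _), integral_const_mul,
        integral_indicator hKm]
    have hlow : c * ∫ x, (F ∘ φ) x ∂μM ≤
        ∫ x, (F ∘ φ) x * h x ∂μM - (p - 1) * ∫ x, (F ∘ φ) x * Y x ∂μM := by
      rw [← integral_const_mul, ← integral_const_mul, ← integral_sub hψh (hψY.const_mul _)]
      refine integral_mono_ae (hψ1.const_mul c) (hψh.sub (hψY.const_mul _)) ?_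
      filter_upwards [hXc] with x hx
      have : (F ∘ φ) x * c ≤ (F ∘ φ) x * ((1 - p) * Y x + h x) :=
        mul_le_mul_of_nonneg_left hx (hψnn x)
      linarith
    have hJle : J ≤ ∫ x, (F ∘ φ) x ∂μM + ε ^ p * (μM).real K := by
      have hind : Integrable (K.indicator fun _ => ε ^ p) μM :=
        (integrable_indicator_iff hKm).2 (by simp [integrableOn_const_iff, hμK])
      have : ∫ x, K.indicator (fun _ => ε ^ p) x ∂μM = ε ^ p * (μM).real K := by
        rw [integral_indicator_const _ hKm, smul_eq_mul, mul_comm]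
      rw [← this, ← integral_add hψ1 hind]
      refine integral_mono habs_int (hψ1.add hind) fun x => ?_
      by_cases hx : x ∈ K
      · simpa [hx] using abs_rpow_le_smoothAbsPow_add hp0.le ε (φ x)
      · simp [hx, hφ0 x hx, hF0, hp0.ne']
    have := mul_le_mul_of_nonneg_left hJle hc.le
    rw [hWval] at hdiv
    rw [hR]
    linarith
  have hlim : c * J ≤ A.toReal := by
    have ht : Tendsto (fun ε : ℝ => A.toReal + ε ^ p * R) (𝓝[>] 0) (𝓝 A.toReal) := by
      have h1 : Tendsto (fun ε : ℝ => ε ^ p) (𝓝[>] 0) (𝓝 0) := by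
        have := (Real.continuousAt_rpow_const 0 p (Or.inr hp0.le)).tendsto
        rw [Real.zero_rpow hp0.ne'] at this
        exact this.mono_left nhdsWithin_le_nhds
      simpa using (h1.mul_const R).const_add A.toReal
    refine ge_of_tendsto ht ?_
    filter_upwards [self_mem_nhdsWithin] with ε hε using key ε hε
  have hJeq : ∫⁻ x, ‖φ x‖ₑ ^ p ∂μM = ENNReal.ofReal J := by
    rw [hJ, ofReal_integral_eq_lintegral_ofReal habs_int
      (ae_of_all _ fun x => Real.rpow_nonneg (abs_nonneg _) _)]
    refine lintegral_congr fun x => ?_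
    rw [Real.enorm_eq_ofReal_abs, ENNReal.ofReal_rpow_of_nonneg (abs_nonneg _) hp0.le]
  rw [hJeq, ← ENNReal.ofReal_mul hc.le]
  exact ENNReal.ofReal_le_of_le_toReal hlim

end Tone

/-! ### Passage to the Sobolev closure and comparison of the tones. -/

section Comparison

variable {n : ℕ} {M : Type*} [EMetricSpace M] [ChartedSpace (EuclideanSpace ℝ (Fin n)) M]
  [IsManifold (𝓡 n) ∞ M] [Bundle.RiemannianBundle (fun x : M => TangentSpace (𝓡 n) x)]
  [MeasurableSpace M]

local notation "μM" => riemannianVolume n M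

/-- The norm `√(g(v, v))` is continuous on the total space of the tangent bundle. -/
theorem MeasurableField.aemeasurable_enorm
    [IsContinuousRiemannianBundle (EuclideanSpace ℝ (Fin n)) (fun x : M => TangentSpace (𝓡 n) x)]
    {Ω : Set M} {G : (x : M) → TangentSpace (𝓡 n) x} (hG : MeasurableField Ω G) :
    AEMeasurable (fun x => ‖G x‖ₑ) ((μM).restrict Ω) := by
  have hc : Continuous fun v : TangentBundle (𝓡 n) M => (inner ℝ v.2 v.2 : ℝ) :=
    Continuous.inner_bundle (F := EuclideanSpace ℝ (Fin n))
      (E := fun x : M => TangentSpace (𝓡 n) x)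
      (b := fun v : TangentBundle (𝓡 n) M => v.1) (v := fun v => v.2) (w := fun v => v.2)
      continuous_id continuous_id
  have hs : Continuous fun v : TangentBundle (𝓡 n) M => √(inner ℝ v.2 v.2 : ℝ) :=
    Real.continuous_sqrt.comp hc
  refine (hs.comp_aestronglyMeasurable hG).aemeasurable.ennreal_ofReal.congr
    (ae_of_all _ fun x => ?_)
  change ENNReal.ofReal √(inner ℝ (G x) (G x)) = ‖G x‖ₑ
  rw [← norm_eq_sqrt_real_inner, ofReal_norm]

/-- After taking `p`-th roots, Minkowski's inequality puts the approximation errors `e k`, `e' k` on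
the right, and they tend to `0`. -/
theorem IsSobolevZero.mul_lintegral_le
    [IsContinuousRiemannianBundle (EuclideanSpace ℝ (Fin n)) (fun x : M => TangentSpace (𝓡 n) x)]
    [OpensMeasurableSpace M] {p : ℝ} (hp : 1 ≤ p) {Ω : Set M} {c : ℝ≥0∞} (hc : c ≠ ⊤)
    (hφ : ∀ φ : M → ℝ, IsTestFunction n Ω φ → c * ∫⁻ x in Ω, ‖φ x‖ₑ ^ p ∂μM ≤
      ∫⁻ x in Ω, ‖(grad φ x : TangentSpace (𝓡 n) x)‖ₑ ^ p ∂μM)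
    {u : M → ℝ} {G : (x : M) → TangentSpace (𝓡 n) x} (hu : IsSobolevZero p Ω u G) :
    c * ∫⁻ x in Ω, ‖u x‖ₑ ^ p ∂μM ≤ ∫⁻ x in Ω, ‖G x‖ₑ ^ p ∂μM := by
  have hp0 : 0 < p := by linarith
  obtain ⟨φ, hφt, hφu, hφG⟩ := hu.approx
  set e : ℕ → ℝ≥0∞ := fun k => (∫⁻ x in Ω, ‖φ k x - u x‖ₑ ^ p ∂μM) ^ (1 / p) with he
  set e' : ℕ → ℝ≥0∞ := fun k => (∫⁻ x in Ω, ‖grad (φ k) x - G x‖ₑ ^ p ∂μM) ^ (1 / p) with he'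
  have hroot : Tendsto (fun t : ℝ≥0∞ => t ^ (1 / p)) (𝓝 0) (𝓝 0) := by
    have := (ENNReal.continuous_rpow_const (y := 1 / p)).tendsto 0
    rwa [ENNReal.zero_rpow_of_pos (by positivity)] at this
  have het : Tendsto e atTop (𝓝 0) := hroot.comp hφu
  have het' : Tendsto e' atTop (𝓝 0) := hroot.comp hφG
  have hcr : c ^ (1 / p) ≠ ⊤ := ENNReal.rpow_ne_top_of_nonneg (by positivity) hc
  have hk : ∀ k, (c * ∫⁻ x in Ω, ‖u x‖ₑ ^ p ∂μM) ^ (1 / p) ≤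
      (∫⁻ x in Ω, ‖G x‖ₑ ^ p ∂μM) ^ (1 / p) + e' k + c ^ (1 / p) * e k := by
    intro k
    have h1 : (∫⁻ x in Ω, ‖u x‖ₑ ^ p ∂μM) ^ (1 / p) ≤
        (∫⁻ x in Ω, ‖φ k x‖ₑ ^ p ∂μM) ^ (1 / p) + e k := by
      refine lintegral_Lp_le_of_le_add hp
        (hφt k).smooth.continuous.measurable.enorm.aemeasurable fun x => ?_
      calc ‖u x‖ₑ = ‖φ k x - (φ k x - u x)‖ₑ := by rw [sub_sub_cancel]
        _ ≤ _ := enorm_sub_le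
    have h2 : (∫⁻ x in Ω, ‖(grad (φ k) x : TangentSpace (𝓡 n) x)‖ₑ ^ p ∂μM) ^ (1 / p) ≤
        (∫⁻ x in Ω, ‖G x‖ₑ ^ p ∂μM) ^ (1 / p) + e' k := by
      refine lintegral_Lp_le_of_le_add hp hu.measurable.aemeasurable_enorm fun x => ?_
      calc ‖(grad (φ k) x : TangentSpace (𝓡 n) x)‖ₑ = ‖G x + (grad (φ k) x - G x)‖ₑ := by
            rw [add_sub_cancel]
        _ ≤ _ := enorm_add_le _ _
    calc (c * ∫⁻ x in Ω, ‖u x‖ₑ ^ p ∂μM) ^ (1 / p)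
        = c ^ (1 / p) * (∫⁻ x in Ω, ‖u x‖ₑ ^ p ∂μM) ^ (1 / p) :=
          ENNReal.mul_rpow_of_nonneg _ _ (by positivity)
      _ ≤ c ^ (1 / p) * ((∫⁻ x in Ω, ‖φ k x‖ₑ ^ p ∂μM) ^ (1 / p) + e k) := by gcongr
      _ = (c * ∫⁻ x in Ω, ‖φ k x‖ₑ ^ p ∂μM) ^ (1 / p) + c ^ (1 / p) * e k := by
          rw [mul_add, ENNReal.mul_rpow_of_nonneg _ _ (by positivity)]
      _ ≤ _ := by
          gcongr
          exact (ENNReal.rpow_le_rpow (hφ _ (hφt k)) (by positivity)).trans h2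
  have hlim : Tendsto (fun k => (∫⁻ x in Ω, ‖G x‖ₑ ^ p ∂μM) ^ (1 / p) + e' k +
      c ^ (1 / p) * e k) atTop (𝓝 ((∫⁻ x in Ω, ‖G x‖ₑ ^ p ∂μM) ^ (1 / p))) := by
    simpa using (het'.const_add _).add (ENNReal.Tendsto.const_mul het (Or.inr hcr))
  exact (ENNReal.rpow_le_rpow_iff (by positivity)).1 (ge_of_tendsto' hlim hk)

theorem IsSobolevZero.le_rayleigh
    [IsContinuousRiemannianBundle (EuclideanSpace ℝ (Fin n)) (fun x : M => TangentSpace (𝓡 n) x)]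
    [OpensMeasurableSpace M] {p : ℝ} (hp : 1 ≤ p) {Ω : Set M} {c : ℝ≥0∞} (hc : c ≠ ⊤)
    (hφ : ∀ φ : M → ℝ, IsTestFunction n Ω φ → c * ∫⁻ x in Ω, ‖φ x‖ₑ ^ p ∂μM ≤
      ∫⁻ x in Ω, ‖(grad φ x : TangentSpace (𝓡 n) x)‖ₑ ^ p ∂μM)
    {u : M → ℝ} {G : (x : M) → TangentSpace (𝓡 n) x} (hu : IsSobolevZero p Ω u G)
    (hu0 : ¬ u =ᵐ[(μM).restrict Ω] 0) : c ≤ rayleigh p Ω u G := by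
  have hp0 : 0 < p := by linarith
  -- The quotient in `ℝ≥0∞` can be cleared only for a finite, nonzero denominator.
  have hfin : ∫⁻ x in Ω, ‖u x‖ₑ ^ p ∂μM ≠ ⊤ := by
    have := lintegral_rpow_enorm_lt_top_of_eLpNorm_lt_top (by simpa using hp0)
      ENNReal.ofReal_ne_top hu.memLp.2
    rw [ENNReal.toReal_ofReal hp0.le] at this
    exact this.ne
  have hne : ∫⁻ x in Ω, ‖u x‖ₑ ^ p ∂μM ≠ 0 := by
    intro h0
    rw [lintegral_eq_zero_iff' (hu.memLp.1.enorm.pow_const p)] at h0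
    refine hu0 ?_
    filter_upwards [h0] with x hx
    simpa [hp0, hp0.not_gt] using hx
  rw [rayleigh, ENNReal.le_div_iff_mul_le (Or.inl hne) (Or.inl hfin)]
  exact hu.mul_lintegral_le hp hc hφ

/-- The fundamental tone of any set is bounded below by the divergence supremum. -/
theorem divergenceSup_le_fundamentalTone
    [IsContinuousRiemannianBundle (EuclideanSpace ℝ (Fin n)) (fun x : M => TangentSpace (𝓡 n) x)]
    [SecondCountableTopology M] [BorelSpace M] {p q : ℝ} (hpq : p.HolderConjugate q) (Ω : Set M) :
    divergenceSup n M p q ≤ (fundamentalTone n p Ω : EReal) := by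
  refine iSup_le fun X => iSup_le fun h => iSup_le fun hX => ?_
  refine EReal.ge_of_forall_gt_iff_ge.1 fun c hc => ?_
  rcases le_or_gt c 0 with hc0 | hc0
  · exact (EReal.coe_nonpos.2 hc0).trans (EReal.coe_ennreal_nonneg _)
  have hXc : ∀ᵐ x ∂μM, c ≤ (1 - p) * ‖X x‖ ^ q + h x := by
    filter_upwards [ae_lt_of_lt_essInf hc] with x hx
    exact (EReal.coe_lt_coe_iff.1 hx).le
  rw [← max_eq_left hc0.le, ← EReal.coe_ennreal_ofReal, EReal.coe_ennreal_le_coe_ennreal_iff]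
  refine le_iInf fun u => le_iInf fun G => le_iInf fun hu => le_iInf fun hu0 =>
    hu.le_rayleigh hpq.lt.le ENNReal.ofReal_ne_top (fun φ hφ => ?_) hu0
  calc ENNReal.ofReal c * ∫⁻ x in Ω, ‖φ x‖ₑ ^ p ∂μM
      ≤ ENNReal.ofReal c * ∫⁻ x, ‖φ x‖ₑ ^ p ∂μM := by
        gcongr
        exact Measure.restrict_le_self
    _ ≤ _ := mul_lintegral_le_lintegral_grad hpq hX hc0 hXc (hφ.mono (subset_univ Ω))
    _ ≤ _ := lintegral_grad_le_of_tsupport_subset hpq.pos hφ.subset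

theorem lintegral_restrict_of_eq_indicator {α : Type*} [MeasurableSpace α] {ν : Measure α}
    {Ω Ω' : Set α} (hΩ : MeasurableSet Ω) (hsub : Ω ⊆ Ω') {f g : α → ℝ≥0∞}
    (hfg : f = Ω.indicator g) : ∫⁻ x in Ω', f x ∂ν = ∫⁻ x in Ω, g x ∂ν := by
  rw [hfg, lintegral_indicator hΩ, Measure.restrict_restrict hΩ, inter_eq_self_of_subset_left hsub]

open scoped Classical in
/-- Extension by zero of a vector field on `Ω`. -/
def extendField (Ω : Set M) (G : (x : M) → TangentSpace (𝓡 n) x) (x : M) :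
    TangentSpace (𝓡 n) x :=
  if x ∈ Ω then G x else 0

theorem MeasurableField.extendField [SecondCountableTopology M] [OpensMeasurableSpace M]
    {Ω Ω' : Set M} (hΩ : MeasurableSet Ω) {G : (x : M) → TangentSpace (𝓡 n) x}
    (hG : MeasurableField Ω G) : MeasurableField Ω' (extendField Ω G) := by
  classical
  have h0 : StronglyMeasurable
      (Bundle.zeroSection (EuclideanSpace ℝ (Fin n)) (fun x : M => TangentSpace (𝓡 n) x)) :=
    (Bundle.Trivialization.continuous_zeroSection ℝ).comp_stronglyMeasurable
      (continuous_id : Continuous (id : M → M)).stronglyMeasurable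
  have h := AEStronglyMeasurable.piecewise (μ := (μM)) hΩ hG h0.aestronglyMeasurable
  refine h.restrict.congr (ae_of_all _ fun x => ?_)
  by_cases hx : x ∈ Ω
  · simp [PTone.extendField, hx]
  · simp [PTone.extendField, hx, Bundle.zeroSection]

/-- The same approximating test functions serve on `Ω'`, since they and their gradients vanish off
`Ω`. -/
theorem IsSobolevZero.extend [SecondCountableTopology M] [OpensMeasurableSpace M] {p : ℝ}
    (hp : 0 < p) {Ω Ω' : Set M} (hΩ : MeasurableSet Ω) (hsub : Ω ⊆ Ω') {u : M → ℝ}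
    {G : (x : M) → TangentSpace (𝓡 n) x} (hu : IsSobolevZero p Ω u G) :
    IsSobolevZero p Ω' (Ω.indicator u) (extendField Ω G) where
  memLp := by
    rw [memLp_indicator_iff_restrict hΩ, Measure.restrict_restrict hΩ,
      inter_eq_self_of_subset_left hsub]
    exact hu.memLp
  measurable := hu.measurable.extendField hΩ
  approx := by
    obtain ⟨φ, hφt, hφu, hφG⟩ := hu.approx
    refine ⟨φ, fun k => (hφt k).mono hsub, hφu.congr fun k => ?_, hφG.congr fun k => ?_⟩
    · refine (lintegral_restrict_of_eq_indicator hΩ hsub (funext fun x => ?_)).symm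
      by_cases hx : x ∈ Ω
      · simp [hx]
      · simp [hx, hp, image_eq_zero_of_notMem_tsupport fun h => hx ((hφt k).subset h)]
    · refine (lintegral_restrict_of_eq_indicator hΩ hsub (funext fun x => ?_)).symm
      by_cases hx : x ∈ Ω
      · simp [extendField, hx]
      · rw [grad_eq_zero_of_notMem_tsupport fun h => hx ((hφt k).subset h)]
        simp [extendField, hx, hp]

/-- Extension by zero makes each competitor on `Ω` one on `Ω'` with the same Rayleigh quotient. -/
theorem fundamentalTone_anti [SecondCountableTopology M] [OpensMeasurableSpace M] {p : ℝ}
    (hp : 0 < p) {Ω Ω' : Set M} (hΩ : MeasurableSet Ω) (hsub : Ω ⊆ Ω') :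
    fundamentalTone n p Ω' ≤ fundamentalTone n p Ω := by
  refine le_iInf fun u => le_iInf fun G => le_iInf fun hu => le_iInf fun hu0 => ?_
  have hne : ¬ Ω.indicator u =ᵐ[(μM).restrict Ω'] 0 := by
    intro h
    refine hu0 ?_
    filter_upwards [ae_restrict_of_ae_restrict_of_subset hsub h, ae_restrict_mem hΩ] with x hx hxΩ
    simpa [hxΩ] using hx
  have hle : fundamentalTone n p Ω' ≤ rayleigh p Ω' (Ω.indicator u) (extendField Ω G) :=
    iInf_le_of_le _ (iInf_le_of_le _ (iInf_le_of_le (hu.extend hp hΩ hsub) (iInf_le _ hne)))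
  refine hle.trans_eq ?_
  unfold rayleigh
  congr 1
  · refine lintegral_restrict_of_eq_indicator hΩ hsub (funext fun x => ?_)
    by_cases hx : x ∈ Ω <;> simp [extendField, hx, hp]
  · refine lintegral_restrict_of_eq_indicator hΩ hsub (funext fun x => ?_)
    by_cases hx : x ∈ Ω <;> simp [hx, hp]

theorem fundamentalTone_univ_le_closedTone (p : ℝ) :
    fundamentalTone n p (univ : Set M) ≤ closedTone n M p := by
  refine le_iInf fun u => le_iInf fun G => le_iInf fun hu => le_iInf fun hu0 => le_iInf fun _ => ?_
  exact iInf_le_of_le u (iInf_le_of_le G (iInf_le_of_le hu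
    (iInf_le_of_le (by rwa [Measure.restrict_univ]) le_rfl)))

end Comparison

end PTone

end

theorem theorem1p2 {n : ℕ} {M : Type*} [EMetricSpace M]
    [ChartedSpace (EuclideanSpace ℝ (Fin n)) M] [IsManifold (𝓡 n) ∞ M]
    [Bundle.RiemannianBundle (fun x : M => TangentSpace (𝓡 n) x)]
    [IsContMDiffRiemannianBundle (𝓡 n) ∞ (EuclideanSpace ℝ (Fin n))
      (fun x : M => TangentSpace (𝓡 n) x)]
    [IsRiemannianManifold (𝓡 n) M] [SecondCountableTopology M]
    [MeasurableSpace M] [BorelSpace M]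
    {p q : ℝ} (hpq : p.HolderConjugate q) :
    -- the infimum over `W₀^{1,p}(M)`
    PTone.divergenceSup n M p q ≤ (PTone.fundamentalTone n p (univ : Set M) : EReal) ∧
    -- the limit of the tones of the geodesic balls around any point
    (∀ o : M, ∃ L : ℝ≥0∞,
      Tendsto (fun r : ℝ => PTone.fundamentalTone n p (Metric.eball o (ENNReal.ofReal r))) atTop
        (𝓝 L) ∧
      PTone.divergenceSup n M p q ≤ (L : EReal)) ∧
    -- the first nonzero eigenvalue, if `M` is closed
    (CompactSpace M → PTone.divergenceSup n M p q ≤ (PTone.closedTone n M p : EReal)) := by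
  have : IsContinuousRiemannianBundle (EuclideanSpace ℝ (Fin n))
      (fun x : M => TangentSpace (𝓡 n) x) := by
    obtain ⟨g, hg, hg'⟩ := IsContMDiffRiemannianBundle.exists_contMDiff (IB := 𝓡 n) (n := ∞)
      (F := EuclideanSpace ℝ (Fin n)) (E := fun x : M => TangentSpace (𝓡 n) x)
    exact ⟨g, hg.continuous, hg'⟩
  refine ⟨PTone.divergenceSup_le_fundamentalTone hpq _, fun o => ?_, fun _ => ?_⟩
  -- Monotonicity makes the limit over `r` the infimum, which may be any value in `[0, ∞]`.
  · have hanti : Antitone fun r : ℝ =>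
        PTone.fundamentalTone n p (Metric.eball o (ENNReal.ofReal r)) := fun r s hrs =>
      PTone.fundamentalTone_anti hpq.pos Metric.isOpen_eball.measurableSet
        (Metric.eball_subset_eball (ENNReal.ofReal_le_ofReal hrs))
    refine ⟨_, tendsto_atTop_iInf hanti, ?_⟩
    refine ge_of_tendsto' ((continuous_coe_ennreal_ereal.tendsto _).comp
      (tendsto_atTop_iInf hanti)) fun r => ?_
    exact PTone.divergenceSup_le_fundamentalTone hpq _
  · exact (PTone.divergenceSup_le_fundamentalTone hpq univ).trans
      (EReal.coe_ennreal_le_coe_ennreal_iff.2 (PTone.fundamentalTone_univ_le_closedTone p))
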